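/- Let $0<p<1$, $q=1-p$, and let $n\ge 1$. There are $n$ places around a circular table, labelled $1,\dots,n$ cyclically so that place $i+1$ is on the right of place $i$ (and place $1$ is on the right of place $n$), with exactly one napkin between each place and the next ($n$ napkins in total). The $n$ guests sit down one at a time, the order in which the places are filled being uniformly random among the $n!$ orders. Independently of this order and of each other, each guest prefers the napkin on his left with probability $p$ and the napkin on his right with probability $q$. When a guest sits down, he takes the adjacent napkin he prefers if it is still available; otherwise he takes the other adjacent napkin if that one is available; otherwise he takes no napkin and is called napkinless. Encode an outcome as a signed permutation $\pi$ of $\{1,\dots,n\}$: $|\pi(i)|$ is the position in the seating order of the guest at place $i$, and $\pi(i)$ is negative if he prefers left and positive if he prefers right. Let $|\pi|_-$ and $|\pi|_+$ be the numbers of negative and positive entries of $\pi$, and let $o(\pi)$ be the number of napkinless guests after everyone is seated. Then the expected number of napkinless guests, $$E_n\big(o(\pi)\big)=\frac1{n!}\sum_{\pi} p^{|\pi|_-}q^{|\pi|_+}\,o(\pi),$$ where the sum is over all $2^n n!$ signed permutations of $\{1,\dots,n\}$, satisfies $$E_n\big(o(\pi)\big)=\frac{n}{pq}\Big(1-p\exp_n(q)-q\exp_n(p)+pq\exp_n(1)\Big),$$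 where $\exp_n(x)=\sum_{k=0}^{n}\frac{x^k}{k!}$ is the truncated exponential series. -/

import Mathlib

open scoped Nat

namespace Napkin

/-- A signed permutation `π` of length `n`, stored as the pair (absolute values, signs).
`π.1 i` is the (zero-based) time at which the guest at place `i` sits down; `π.2 i` is the sign:
`true` (plus) if that guest prefers the right napkin, `false` (minus) if he prefers the left. -/
abbrev SignedPerm (n : ℕ) : Type := Equiv.Perm (Fin n) × (Fin n → Bool)

/-- The napkin on the left of place `i`. Places are in cyclic order, place `i + 1` being on the
right of place `i` (cyclically); napkin `i` lies between the places `i - 1` and `i`. -/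
def leftNapkin {n : ℕ} (i : Fin n) : Fin n := i

/-- The napkin on the right of place `i`: the one on the left of the cyclically next place. -/
def rightNapkin {n : ℕ} (i : Fin n) : Fin n := finRotate n i

/-- The napkin that the guest at place `i` prefers. -/
def preferredNapkin {n : ℕ} (π : SignedPerm n) (i : Fin n) : Fin n :=
  if π.2 i then rightNapkin i else leftNapkin i

/-- The other napkin adjacent to place `i`. -/
def otherNapkin {n : ℕ} (π : SignedPerm n) (i : Fin n) : Fin n :=
  if π.2 i then leftNapkin i else rightNapkin i

/-- A state of the table: the napkin held at each place (`none` if no napkin is held there). -/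
abbrev TableState (n : ℕ) : Type := Fin n → Option (Fin n)

/-- Napkin `k` is still on the table. -/
def Available {n : ℕ} (T : TableState n) (k : Fin n) : Prop := ∀ j, T j ≠ some k

instance {n : ℕ} (T : TableState n) (k : Fin n) : Decidable (Available T k) :=
  inferInstanceAs (Decidable (∀ j, T j ≠ some k))

/-- The guest at place `i` sits down: he takes the napkin he prefers if it is available, otherwise
the other adjacent napkin if that one is available, otherwise none. -/
def sitDown {n : ℕ} (π : SignedPerm n) (T : TableState n) (i : Fin n) : TableState n :=
  Function.update T i
    (if Available T (preferredNapkin π i) then some (preferredNapkin π i)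
     else if Available T (otherNapkin π i) then some (otherNapkin π i)
     else none)

/-- The state of the table after the first `t` guests have sat down. -/
def tableAfter {n : ℕ} (π : SignedPerm n) : ℕ → TableState n
  | 0 => fun _ => none
  | t + 1 => if h : t < n then sitDown π (tableAfter π t) (π.1.symm ⟨t, h⟩) else tableAfter π t

/-- `o(π)`: the number of guests without a napkin once all `n` guests are seated. -/
def numNapkinless {n : ℕ} (π : SignedPerm n) : ℕ :=
  (Finset.univ.filter fun i : Fin n => tableAfter π n i = none).card

/-- `|π|₋`: the number of negative entries (guests who prefer the left napkin). -/
def numNeg {n : ℕ} (π : SignedPerm n) : ℕ := (Finset.univ.filter fun i : Fin n => π.2 i = false).card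

/-- `|π|₊`: the number of positive entries (guests who prefer the right napkin). -/
def numPos {n : ℕ} (π : SignedPerm n) : ℕ := (Finset.univ.filter fun i : Fin n => π.2 i = true).card

/-- The probability of the signed permutation `π`: the seating order is uniform among the `n!`
orders and, independently, each guest prefers left with probability `p` and right with
probability `q`. -/
noncomputable def prob {n : ℕ} (p q : ℝ) (π : SignedPerm n) : ℝ :=
  p ^ numNeg π * q ^ numPos π / (n ! : ℝ)

/-- The expected number of napkinless guests at a circular table for `n` people. -/
noncomputable def expectedNapkinless (n : ℕ) (p q : ℝ) : ℝ :=
  ∑ π : SignedPerm n, prob p q π * (numNapkinless π : ℝ)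

/-- The truncated exponential series `∑_{k=0}^n x^k / k!`. -/
noncomputable def truncExp (n : ℕ) (x : ℝ) : ℝ :=
  ∑ k ∈ Finset.range (n + 1), x ^ k / (k ! : ℝ)

/-- The weights `prob p q` are those of a probability distribution: they sum to `1`. -/
theorem sum_prob (n : ℕ) (p q : ℝ) (hpq : p + q = 1) :
    ∑ π : SignedPerm n, prob p q π = 1 := by
  have h (π : SignedPerm n) :
      p ^ numNeg π * q ^ numPos π = ∏ i : Fin n, (if π.2 i = true then q else p) := by
    rw [Finset.prod_ite, Finset.prod_const, Finset.prod_const, mul_comm]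
    simp [numNeg, numPos]
  have h2 : ∑ s : Fin n → Bool, ∏ i : Fin n, (if s i = true then q else p) = 1 := by
    rw [← Fintype.prod_sum (fun (_ : Fin n) (b : Bool) => if b = true then q else p)]
    simp [add_comm q p, hpq]
  simp only [prob, h]
  rw [← Finset.sum_div, Fintype.sum_prod_type]
  simp only [h2]
  simp [Fintype.card_perm, Nat.factorial_ne_zero]

end Napkin

/-!
The expectation is computed place by place. A guest is napkinless exactly if both napkins next to
him are gone when he sits down. His left napkin is gone precisely if his left neighbour is already
seated and either prefers right or has himself lost his left napkin (`leftTaken_finRotate_iff`).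
Unfolding this recursion, which ends because the seating times decrease, gives a unique `k` such
that the `k` nearest guests on the left prefer left, the next one prefers right, and these `k + 1`
guests and then the guest himself sit down from left to right (`LeftChain`, `iff_exists_isChain`).
Mirror images describe the right napkin, with a chain of `l + 1` guests (`RightChain`).

The two chains cannot overlap around the table, so `k + l + 3 ≤ n` (`add_add_le_of_chains`). For
fixed `k` and `l` the required order concerns `k + l + 3` distinct places: the guest comes last, and
each chain is in one prescribed order, which has probability
`1 / ((k + l + 3) (k + 1)! (l + 1)!)` (`card_order_pattern`). The required preferences have
probability `p ^ k q · q ^ l p` (`sum_prod_ite_forall`). By the binomial theorem, the sum of the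
products over `k + l = m` is `(1 - p ^ (m + 2) - q ^ (m + 2)) / (m + 3)!`
(`sum_antidiagonal_interior`), and summing over `m + 3 ≤ n` yields the truncated exponentials, since
the terms of degree `0`, `1`, `2` of the claimed expression cancel (`sum_interior_eq_truncExp`).
-/

open scoped Nat

namespace Napkin

/-! ### The seating process -/

section Seating

variable {n : ℕ} (π : SignedPerm n)

theorem tableAfter_eq_none_of_le {i : Fin n} {t : ℕ} (h : t ≤ π.1 i) :
    tableAfter π t i = none := by
  induction t with
  | zero => rfl
  | succ t ih =>
    rw [tableAfter]
    split_ifs with ht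
    · have hne : i ≠ π.1.symm ⟨t, ht⟩ := by
        rintro rfl
        simp at h
      rw [sitDown, Function.update_of_ne hne, ih (by omega)]
    · exact ih (by omega)

theorem tableAfter_eq_of_lt {i : Fin n} {t : ℕ} (h : (π.1 i : ℕ) < t) :
    tableAfter π t i = tableAfter π (π.1 i + 1) i := by
  induction t with
  | zero => omega
  | succ t ih =>
    rcases Nat.lt_succ_iff_lt_or_eq.mp h with h' | h'
    · rw [tableAfter]
      split_ifs with ht
      · have hne : i ≠ π.1.symm ⟨t, ht⟩ := by
          rintro rfl
          simp at h'
        rw [sitDown, Function.update_of_ne hne, ih h']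
      · exact ih h'
    · rw [h']

/-- The napkin (if any) held at place `i` at the end is the one chosen at the moment when the
guest at place `i` sat down. -/
theorem tableAfter_last (i : Fin n) :
    tableAfter π n i =
      if Available (tableAfter π (π.1 i)) (preferredNapkin π i) then some (preferredNapkin π i)
      else if Available (tableAfter π (π.1 i)) (otherNapkin π i) then some (otherNapkin π i)
      else none := by
  rw [tableAfter_eq_of_lt π (π.1 i).isLt, tableAfter, dif_pos (π.1 i).isLt]
  simp [sitDown]

theorem available_tableAfter_iff (t : ℕ) (k : Fin n) :
    Available (tableAfter π t) k ↔
      ∀ j, (π.1 j : ℕ) < t → tableAfter π n j ≠ some k := by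
  refine forall_congr' fun j => ?_
  rcases lt_or_ge (π.1 j : ℕ) t with h | h
  · simp [h, tableAfter_eq_of_lt π h, tableAfter_eq_of_lt π (π.1 j).isLt]
  · simp [tableAfter_eq_none_of_le π h, not_lt.mpr h]

theorem adjacent_of_tableAfter_eq_some {j k : Fin n} (h : tableAfter π n j = some k) :
    j = k ∨ finRotate n j = k := by
  rw [tableAfter_last] at h
  simp only [preferredNapkin, otherNapkin, leftNapkin, rightNapkin] at h
  split_ifs at h <;> simp_all

/-- The left napkin of the guest at place `i` is gone when he sits down. -/
def LeftTaken (i : Fin n) : Prop := ¬ Available (tableAfter π (π.1 i)) (leftNapkin i)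

/-- The right napkin of the guest at place `i` is gone when he sits down. -/
def RightTaken (i : Fin n) : Prop := ¬ Available (tableAfter π (π.1 i)) (rightNapkin i)

theorem tableAfter_last_eq_none_iff (i : Fin n) :
    tableAfter π n i = none ↔ LeftTaken π i ∧ RightTaken π i := by
  rw [tableAfter_last, LeftTaken, RightTaken, preferredNapkin, otherNapkin]
  cases π.2 i <;> simp only [Bool.false_eq_true, if_true, if_false] <;> split_ifs <;> simp_all

/-- The left napkin of a guest disappears before he sits down precisely if his left neighbour is
already there and either wanted that napkin or was himself deprived of his left napkin. -/
theorem leftTaken_finRotate_iff (i : Fin n) :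
    LeftTaken π (finRotate n i) ↔
      π.1 i < π.1 (finRotate n i) ∧ (π.2 i = true ∨ LeftTaken π i) := by
  constructor
  · intro h
    rw [LeftTaken, available_tableAfter_iff] at h
    push Not at h
    obtain ⟨j, hj, hjs⟩ := h
    rcases adjacent_of_tableAfter_eq_some π hjs with rfl | h'
    · exact absurd hj (lt_irrefl _)
    obtain rfl : j = i := (finRotate n).injective h'
    refine ⟨hj, ?_⟩
    have hne : leftNapkin j ≠ leftNapkin (finRotate n j) := by
      intro e
      simp only [leftNapkin] at e
      rw [← e] at hj
      exact lt_irrefl _ hj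
    by_contra! hc
    rw [tableAfter_last, preferredNapkin, if_neg hc.1, if_pos (not_not.mp hc.2)] at hjs
    exact hne (Option.some_injective _ hjs)
  · rintro ⟨hlt, h⟩
    have hav : Available (tableAfter π (π.1 i)) (rightNapkin i) := by
      rw [available_tableAfter_iff]
      intro j hj hjs
      rcases adjacent_of_tableAfter_eq_some π hjs with rfl | h'
      · exact lt_asymm hlt hj
      · obtain rfl : j = i := (finRotate n).injective h'
        exact lt_irrefl _ hj
    rw [LeftTaken, available_tableAfter_iff]
    push Not
    refine ⟨i, hlt, ?_⟩
    rw [tableAfter_last, preferredNapkin, otherNapkin]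
    by_cases hs : π.2 i = true
    · rw [if_pos hs, if_pos hav]
      rfl
    · rw [if_neg hs, if_neg (h.resolve_left hs), if_neg hs, if_pos hav]
      rfl

/-- The mirror image of `leftTaken_finRotate_iff`. -/
theorem rightTaken_iff (i : Fin n) :
    RightTaken π i ↔
      π.1 (finRotate n i) < π.1 i ∧
        (π.2 (finRotate n i) = false ∨ RightTaken π (finRotate n i)) := by
  constructor
  · intro h
    rw [RightTaken, available_tableAfter_iff] at h
    push Not at h
    obtain ⟨j, hj, hjs⟩ := h
    rcases adjacent_of_tableAfter_eq_some π hjs with rfl | h'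
    swap
    · obtain rfl : j = i := (finRotate n).injective h'
      exact absurd hj (lt_irrefl _)
    refine ⟨hj, ?_⟩
    rw [rightNapkin] at hj hjs
    have hne : rightNapkin (finRotate n i) ≠ finRotate n i := by
      intro e
      rw [(finRotate n).injective e] at hj
      exact lt_irrefl _ hj
    by_contra! hc
    rw [tableAfter_last, preferredNapkin, if_pos (Bool.eq_true_of_not_eq_false hc.1),
      if_pos (not_not.mp hc.2)] at hjs
    exact hne (Option.some_injective _ hjs)
  · rintro ⟨hlt, h⟩
    have hav : Available (tableAfter π (π.1 (finRotate n i))) (leftNapkin (finRotate n i)) := by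
      rw [available_tableAfter_iff]
      intro j hj hjs
      rcases adjacent_of_tableAfter_eq_some π hjs with rfl | h'
      · exact lt_irrefl _ hj
      · obtain rfl : j = i := (finRotate n).injective h'
        exact lt_asymm hlt hj
    rw [RightTaken, available_tableAfter_iff]
    push Not
    refine ⟨finRotate n i, hlt, ?_⟩
    rw [tableAfter_last, preferredNapkin, otherNapkin]
    by_cases hs : π.2 (finRotate n i) = true
    · have hR : RightTaken π (finRotate n i) := h.resolve_left fun h => by
        rw [hs] at h
        exact Bool.noConfusion h
      rw [if_pos hs, if_neg hR, if_pos hs, if_pos hav]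
      rfl
    · rw [if_neg hs, if_pos hav]
      rfl

end Seating

/-! ### Displacement chains -/

/-- Walking from `i` along `r`, the values of `f` decrease over the first `k + 1` steps, and the
place reached by the last of these steps is the first one (after `i`) that satisfies `s`. -/
def IsChain {α : Type*} {β : Type*} [LT β] (r : α → α) (f : α → β) (s : α → Prop) (i : α)
    (k : ℕ) : Prop :=
  (∀ j ≤ k, f (r^[j + 1] i) < f (r^[j] i)) ∧ (∀ j < k, ¬ s (r^[j + 1] i)) ∧ s (r^[k + 1] i)

theorem IsChain.unique {α β : Type*} [LT β] {r : α → α} {f : α → β} {s : α → Prop} {i : α}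
    {k l : ℕ} (hk : IsChain r f s i k) (hl : IsChain r f s i l) : k = l := by
  by_contra h
  rcases Nat.lt_or_gt_of_ne h with h | h
  · exact hl.2.1 k h hk.2.2
  · exact hk.2.1 l h hl.2.2

/-- Unfolding the recursion for `LeftTaken` or `RightTaken` along the table. -/
theorem iff_exists_isChain {α : Type*} {n : ℕ} {r : α → α} {f : α → Fin n}
    {s P : α → Prop} (hP : ∀ i, P i ↔ f (r i) < f i ∧ (s (r i) ∨ P (r i))) (i : α) :
    P i ↔ ∃ k, IsChain r f s i k := by
  induction hm : (f i : ℕ) using Nat.strong_induction_on generalizing i with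
  | _ m ih =>
    rw [hP]
    constructor
    · rintro ⟨hlt, h⟩
      by_cases hs : s (r i)
      · exact ⟨0, by simpa using hlt, by simp, hs⟩
      · obtain ⟨k, h1, h2, h3⟩ := (ih _ (by omega) (r i) rfl).mp (h.resolve_left hs)
        refine ⟨k + 1, fun j hj => ?_, fun j hj => ?_, h3⟩
        · cases j with
          | zero => exact hlt
          | succ j => exact h1 j (by omega)
        · cases j with
          | zero => exact hs
          | succ j => exact h2 j (by omega)
    · rintro ⟨k, h1, h2, h3⟩
      have hlt : f (r i) < f i := h1 0 (Nat.zero_le _)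
      refine ⟨hlt, ?_⟩
      cases k with
      | zero => exact Or.inl h3
      | succ k =>
        exact Or.inr ((ih _ (by omega) (r i) rfl).mpr
          ⟨k, fun j hj => h1 (j + 1) (by omega), fun j hj => h2 (j + 1) (by omega), h3⟩)

theorem lt_of_forall_succ_lt {n k : ℕ} {v : ℕ → Fin n} (h : ∀ j ≤ k, v (j + 1) < v j)
    {a b : ℕ} (hab : a < b) (hb : b ≤ k + 1) : v b < v a := by
  induction b, hab using Nat.le_induction with
  | base => exact h a (by omega)
  | succ b _ ih => exact (h b (by omega)).trans (ih (by omega))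

theorem forall_succ_lt_iff {n k : ℕ} (v : ℕ → Fin n) :
    (∀ j ≤ k, v (j + 1) < v j) ↔
      (∀ j : Fin (k + 1), v (j + 1) < v 0) ∧ StrictAnti fun j : Fin (k + 1) => v (j + 1) := by
  constructor
  · intro h
    exact ⟨fun j => lt_of_forall_succ_lt h (by omega) (by omega),
      fun a b hab => lt_of_forall_succ_lt h (by simpa using hab) (by omega)⟩
  · rintro ⟨h0, h1⟩ j hj
    cases j with
    | zero => exact h0 0
    | succ j =>
      exact h1 (a := ⟨j, by omega⟩) (b := ⟨j + 1, by omega⟩) (by simp [Fin.lt_def])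

/-! ### Counting seating orders with prescribed patterns -/

/-- An injective word can be sorted into decreasing order in exactly one way. -/
theorem existsUnique_strictAnti_comp {k : ℕ} {β : Type*} [LinearOrder β] (h : Fin k → β)
    (hh : Function.Injective h) : ∃! τ : Equiv.Perm (Fin k), StrictAnti (h ∘ τ) := by
  let h' : Fin k → βᵒᵈ := OrderDual.toDual ∘ h
  have hinj : Function.Injective h' := OrderDual.toDual.injective.comp hh
  have key (τ : Equiv.Perm (Fin k)) : StrictAnti (h ∘ τ) ↔ StrictMono (h' ∘ τ) := Iff.rfl
  simp only [key]
  refine ⟨Tuple.sort h', (Tuple.monotone_sort h').strictMono_of_injective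
    (hinj.comp (Tuple.sort h').injective), fun τ hτ => ?_⟩
  have hs : StrictMono (h' ∘ Tuple.sort h') := (Tuple.monotone_sort h').strictMono_of_injective
    (hinj.comp (Tuple.sort h').injective)
  have : h' ∘ τ = h' ∘ Tuple.sort h' :=
    (StrictMono.range_inj hτ hs).mp (by simp [Set.range_comp])
  ext1 x
  exact hinj (congrFun this x)

/-- If a property of seating orders does not change when the places in the image of `f` are
permuted, then a fraction `1 / k!` of the orders with this property is decreasing along `f`. -/
theorem card_filter_eq_factorial_mul {n k : ℕ} (f : Fin k ↪ Fin n)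
    (P : Equiv.Perm (Fin n) → Prop) [DecidablePred P]
    (hP : ∀ (σ : Equiv.Perm (Fin n)) (τ : Equiv.Perm (Fin k)),
      P (σ * τ.viaFintypeEmbedding f) ↔ P σ)
    [DecidablePred fun σ : Equiv.Perm (Fin n) => P σ ∧ StrictAnti (σ ∘ f)] :
    (Finset.univ.filter P).card =
      k ! * (Finset.univ.filter fun σ => P σ ∧ StrictAnti (σ ∘ f)).card := by
  have hcomp (σ : Equiv.Perm (Fin n)) (τ : Equiv.Perm (Fin k)) :
      (σ * τ.viaFintypeEmbedding f : Equiv.Perm (Fin n)) ∘ f = (σ ∘ f) ∘ τ := by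
    funext a
    simp
  have hinj (σ : Equiv.Perm (Fin n)) : Function.Injective (σ ∘ f) := σ.injective.comp f.injective
  have hfib (τ : Equiv.Perm (Fin k)) :
      (Finset.univ.filter fun σ => P σ ∧ StrictAnti ((σ ∘ f) ∘ τ)).card =
        (Finset.univ.filter fun σ => P σ ∧ StrictAnti (σ ∘ f)).card := by
    refine Finset.card_equiv (Equiv.mulRight (τ.viaFintypeEmbedding f)) fun σ => ?_
    simp only [Finset.mem_filter, Finset.mem_univ, true_and, Equiv.coe_mulRight, hP, hcomp]
  have hunion : Finset.univ.filter P = Finset.univ.biUnion fun τ : Equiv.Perm (Fin k) =>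
      Finset.univ.filter fun σ => P σ ∧ StrictAnti ((σ ∘ f) ∘ τ) := by
    ext σ
    obtain ⟨τ, hτ, -⟩ := existsUnique_strictAnti_comp (σ ∘ f) (hinj σ)
    simp only [Finset.mem_filter, Finset.mem_univ, true_and, Finset.mem_biUnion]
    exact ⟨fun h => ⟨τ, h, hτ⟩, fun ⟨_, h, _⟩ => h⟩
  rw [hunion, Finset.card_biUnion]
  · simp only [hfib]
    simp [Fintype.card_perm]
  · intro τ _ τ' _ hne
    rw [Function.onFun, Finset.disjoint_left]
    intro σ h h'
    simp only [Finset.mem_filter, Finset.mem_univ, true_and] at h h'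
    exact hne ((existsUnique_strictAnti_comp (σ ∘ f) (hinj σ)).unique h.2 h'.2)

theorem forall_viaFintypeEmbedding_apply_iff {n k m : ℕ} (f : Fin k ↪ Fin n) (g : Fin m → Fin n)
    (hfg : Set.range f ⊆ Set.range g) (τ : Equiv.Perm (Fin k)) (Q : Fin n → Prop) :
    (∀ j, Q (τ.viaFintypeEmbedding f (g j))) ↔ ∀ j, Q (g j) := by
  have hmaps (τ : Equiv.Perm (Fin k)) (j : Fin m) :
      τ.viaFintypeEmbedding f (g j) ∈ Set.range g := by
    by_cases h : g j ∈ Set.range f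
    · obtain ⟨a, ha⟩ := h
      rw [← ha, Equiv.Perm.viaFintypeEmbedding_apply_image]
      exact hfg ⟨_, rfl⟩
    · rw [Equiv.Perm.viaFintypeEmbedding_apply_notMem_range _ _ h]
      exact ⟨j, rfl⟩
  have hinv (j : Fin m) :
      τ.viaFintypeEmbedding f ((τ⁻¹).viaFintypeEmbedding f (g j)) = g j := by
    by_cases h : g j ∈ Set.range f
    · obtain ⟨a, ha⟩ := h
      simp [← ha]
    · simp only [Equiv.Perm.viaFintypeEmbedding_apply_notMem_range _ _ h]
  constructor
  · intro h j
    obtain ⟨i, hi⟩ := hmaps τ⁻¹ j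
    have := h i
    rwa [hi, hinv] at this
  · intro h j
    obtain ⟨i, hi⟩ := hmaps τ j
    rw [← hi]
    exact h i

/-- Among the `n!` seating orders, a fraction `1 / ((k + l + 1) k! l!)` fills the place `c` after
the places `x 0, …, x (k - 1), y 0, …, y (l - 1)` and is decreasing along `x` and along `y`. -/
theorem card_order_pattern {n k l : ℕ} (c : Fin n) (x : Fin k ↪ Fin n) (y : Fin l ↪ Fin n)
    (hxc : ∀ a, x a ≠ c) (hyc : ∀ b, y b ≠ c) (hxy : ∀ a b, x a ≠ y b)
    [DecidablePred fun σ : Equiv.Perm (Fin n) =>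
      (((∀ j, σ (x j) < σ c) ∧ (∀ j, σ (y j) < σ c)) ∧ StrictAnti (σ ∘ x)) ∧ StrictAnti (σ ∘ y)] :
    (k + l + 1) * (k ! * l !) * (Finset.univ.filter fun σ : Equiv.Perm (Fin n) =>
      (((∀ j, σ (x j) < σ c) ∧ (∀ j, σ (y j) < σ c)) ∧ StrictAnti (σ ∘ x)) ∧
        StrictAnti (σ ∘ y)).card = n ! := by
  classical
  let g : Fin (k + l) ↪ Fin n := ⟨Fin.append x y,
    Fin.append_injective_iff.mpr ⟨x.injective, y.injective, hxy⟩⟩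
  have hgc : ∀ j, g j ≠ c := by
    intro j
    refine Fin.addCases (fun a => ?_) (fun b => ?_) j
    · simpa [g] using hxc a
    · simpa [g] using hyc b
  let F : Fin (k + l + 1) ↪ Fin n := ⟨Fin.cons c g, Fin.cons_injective_iff.mpr
    ⟨by rintro ⟨j, hj⟩; exact hgc j hj, g.injective⟩⟩
  have hmax (σ : Equiv.Perm (Fin n)) :
      (∀ j, σ (g j) < σ c) ↔ (∀ j, σ (x j) < σ c) ∧ (∀ j, σ (y j) < σ c) := by
    constructor
    · intro h
      exact ⟨fun a => by simpa [g] using h (Fin.castAdd l a),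
        fun b => by simpa [g] using h (Fin.natAdd k b)⟩
    · rintro ⟨h1, h2⟩ j
      refine Fin.addCases (fun a => ?_) (fun b => ?_) j
      · simpa [g] using h1 a
      · simpa [g] using h2 b
  have hfix {m : ℕ} (f : Fin m ↪ Fin n) (τ : Equiv.Perm (Fin m)) {z : Fin n}
      (hz : ∀ a, f a ≠ z) : τ.viaFintypeEmbedding f z = z :=
    Equiv.Perm.viaFintypeEmbedding_apply_notMem_range _ _ (by rintro ⟨a, ha⟩; exact hz a ha)
  have hmaxinv {m : ℕ} (f : Fin m ↪ Fin n) (hf : Set.range f ⊆ Set.range g)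
      (σ : Equiv.Perm (Fin n)) (τ : Equiv.Perm (Fin m)) :
      (∀ j, (σ * τ.viaFintypeEmbedding f : Equiv.Perm (Fin n)) (g j) <
        (σ * τ.viaFintypeEmbedding f : Equiv.Perm (Fin n)) c) ↔ ∀ j, σ (g j) < σ c := by
    have hc : τ.viaFintypeEmbedding f c = c := hfix f τ (by
      intro a ha
      obtain ⟨j, hj⟩ := hf ⟨a, rfl⟩
      exact hgc j (hj.trans ha))
    simp only [Equiv.Perm.mul_apply, hc]
    exact forall_viaFintypeEmbedding_apply_iff f g hf τ (fun z => σ z < σ c)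
  have hxg : Set.range x ⊆ Set.range g := by
    rintro _ ⟨a, rfl⟩
    exact ⟨Fin.castAdd l a, by simp [g]⟩
  have hyg : Set.range y ⊆ Set.range g := by
    rintro _ ⟨a, rfl⟩
    exact ⟨Fin.natAdd k a, by simp [g]⟩
  -- Sorting all orders along `c, x, y`, or those in which `c` comes last along `x, y`, gives the
  -- same set of orders.
  have h1 := card_filter_eq_factorial_mul F (fun _ => True) (fun _ _ => Iff.rfl)
  have h2 := card_filter_eq_factorial_mul g (fun σ => ∀ j, σ (g j) < σ c)
    (hmaxinv g subset_rfl)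
  have hcons (σ : Equiv.Perm (Fin n)) :
      True ∧ StrictAnti (σ ∘ F) ↔ (∀ j, σ (g j) < σ c) ∧ StrictAnti (σ ∘ g) := by
    rw [true_and]
    constructor
    · intro h
      exact ⟨fun j => h (Fin.succ_pos j), fun a b hab => h (Fin.succ_lt_succ_iff.mpr hab)⟩
    · rintro ⟨ha, hb⟩ i j hij
      cases j using Fin.cases with
      | zero => exact absurd hij (Fin.not_lt_zero i)
      | succ j =>
        cases i using Fin.cases with
        | zero => exact ha j
        | succ i => exact hb (Fin.succ_lt_succ_iff.mp hij)
  simp only [hcons] at h1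
  -- The orders in which `c` comes last are now sorted along `x` and along `y` separately.
  have h3 := card_filter_eq_factorial_mul x (fun σ => ∀ j, σ (g j) < σ c) (hmaxinv x hxg)
  have h4 := card_filter_eq_factorial_mul y
    (fun σ => (∀ j, σ (g j) < σ c) ∧ StrictAnti (σ ∘ x)) (fun σ τ => by
      refine and_congr (hmaxinv y hyg σ τ) ?_
      have : (σ * τ.viaFintypeEmbedding y : Equiv.Perm (Fin n)) ∘ x = σ ∘ x := by
        funext a
        simp [hfix y τ (fun b => (hxy a b).symm)]
      rw [this])
  simp only [hmax] at h1 h2 h3 h4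
  simp only [Finset.filter_true, Finset.card_univ, Fintype.card_perm, Fintype.card_fin] at h1
  have h5 := h2.symm.trans (h3.trans (congrArg (k ! * ·) h4))
  simp only [← mul_assoc (k !)] at h5
  rw [h1, Nat.factorial_succ, mul_assoc (k + l + 1) (k ! * l !), mul_assoc (k + l + 1) (k + l)!, h5]

/-! ### Preferences -/

/-- The probability that the guests at the distinct places `g 0, …, g (m - 1)` have prescribed
preferences is the product of the single probabilities. -/
theorem sum_prod_ite_forall {ι : Type*} [Fintype ι] [DecidableEq ι] {m : ℕ} (g : Fin m ↪ ι)
    (b : Fin m → Bool) (w : Bool → ℝ) (hw : w true + w false = 1) :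
    ∑ s : ι → Bool, (if ∀ j, s (g j) = b j then ∏ i, w (s i) else 0) = ∏ j, w (b j) := by
  classical
  have h (s : ι → Bool) : (if ∀ j, s (g j) = b j then ∏ i, w (s i) else 0) =
      ∏ i, if ∀ j, g j = i → s i = b j then w (s i) else 0 := by
    split_ifs with hs
    · refine Finset.prod_congr rfl fun i _ => ?_
      rw [if_pos]
      rintro j rfl
      exact hs j
    · push Not at hs
      obtain ⟨j, hj⟩ := hs
      refine (Finset.prod_eq_zero (Finset.mem_univ (g j)) (if_neg ?_)).symm
      exact fun h => hj (h j rfl)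
  simp only [h]
  rw [← Fintype.prod_sum (fun i c => if ∀ j, g j = i → c = b j then w c else 0)]
  have hmem (j : Fin m) : (∑ c, if ∀ j', g j' = g j → c = b j' then w c else 0) = w (b j) := by
    simp
  rw [← Finset.prod_subset (Finset.subset_univ (Finset.univ.map g)), Finset.prod_map]
  · exact Finset.prod_congr rfl fun j _ => hmem j
  · intro i _ hi
    have : ∀ j, g j ≠ i := by simpa using hi
    simp [this, hw]

theorem prod_fin_succ_ite_last (k : ℕ) (u v : ℝ) :
    ∏ j : Fin (k + 1), (if (j : ℕ) = k then u else v) = v ^ k * u := by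
  rw [Fin.prod_univ_castSucc]
  simp [fun i : Fin k => i.isLt.ne]

/-! ### The probability that a given guest is napkinless -/

section Cyclic

variable {N : ℕ}

theorem iterate_finRotate_val (i : Fin (N + 1)) (j : ℕ) :
    (((finRotate (N + 1))^[j] i : Fin (N + 1)) : ℕ) = (i + j) % (N + 1) := by
  induction j with
  | zero => simp [Nat.mod_eq_of_lt i.isLt]
  | succ j ih =>
    rw [Function.iterate_succ_apply', finRotate_apply, Fin.val_add, ih]
    simp [add_assoc]

theorem iterate_finRotate_self (i : Fin (N + 1)) : (finRotate (N + 1))^[N + 1] i = i := by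
  ext
  rw [iterate_finRotate_val, Nat.add_mod_right, Nat.mod_eq_of_lt i.isLt]

theorem iterate_finRotate_inj {i : Fin (N + 1)} {a b : ℕ} (ha : a < N + 1) (hb : b < N + 1)
    (h : (finRotate (N + 1))^[a] i = (finRotate (N + 1))^[b] i) : a = b := by
  have h' := congrArg Fin.val h
  rw [iterate_finRotate_val, iterate_finRotate_val] at h'
  have := Nat.ModEq.add_left_cancel' (i : ℕ) h'
  exact Nat.ModEq.eq_of_lt_of_lt this ha hb

/-- Going `a` places to the left is the same as going `N + 1 - a` places to the right. -/
theorem iterate_finRotate_symm {a b : ℕ} (hab : a + b = N + 1) (i : Fin (N + 1)) :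
    (finRotate (N + 1)).symm^[a] i = (finRotate (N + 1))^[b] i := by
  have h : (finRotate (N + 1))^[a] ((finRotate (N + 1))^[b] i) = i := by
    rw [← Function.iterate_add_apply, hab, iterate_finRotate_self]
  conv_lhs => rw [← h]
  exact (Function.LeftInverse.iterate (finRotate (N + 1)).symm_apply_apply a) _

variable (π : SignedPerm (N + 1)) (i : Fin (N + 1))

/-- The guest at place `i - (k + 1)` prefers right, the guests at the `k` places between him and
`i` prefer left, and all these guests and the guest at `i` sit down from left to right. -/
def LeftChain (k : ℕ) : Prop :=
  IsChain (finRotate (N + 1)).symm π.1 (fun j => π.2 j = true) i k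

/-- The mirror image of `LeftChain`, at the right of place `i`. -/
def RightChain (k : ℕ) : Prop :=
  IsChain (finRotate (N + 1)) π.1 (fun j => π.2 j = false) i k

theorem tableAfter_last_eq_none_iff_exists_chain :
    tableAfter π (N + 1) i = none ↔ (∃ k, LeftChain π i k) ∧ ∃ l, RightChain π i l := by
  rw [tableAfter_last_eq_none_iff]
  refine and_congr (iff_exists_isChain (fun i => ?_) i) (iff_exists_isChain (rightTaken_iff π) i)
  have h := leftTaken_finRotate_iff π ((finRotate (N + 1)).symm i)
  rwa [Equiv.apply_symm_apply] at h

variable {π i}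

/-- A left and a right chain of the same guest cannot meet around the table: the guest where they
meet would have to prefer both napkins, or two neighbours would sit down in both orders. -/
theorem add_add_le_of_chains {k l : ℕ} (hL : LeftChain π i k) (hR : RightChain π i l) :
    k + l + 3 ≤ N + 1 := by
  have hk : k + 1 < N + 1 := by
    by_contra! h
    have h1 := lt_of_forall_succ_lt (v := fun j => π.1 ((finRotate (N + 1)).symm^[j] i))
      hL.1 (Nat.succ_pos N) (by omega)
    simp only [Function.iterate_zero, id] at h1
    rw [iterate_finRotate_symm (b := 0) (by omega)] at h1
    exact lt_irrefl _ h1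
  have hl : l + 1 < N + 1 := by
    by_contra! h
    have h1 := lt_of_forall_succ_lt (v := fun j => π.1 ((finRotate (N + 1))^[j] i))
      hR.1 (Nat.succ_pos N) (by omega)
    simp only [Function.iterate_zero, id] at h1
    rw [iterate_finRotate_self] at h1
    exact lt_irrefl _ h1
  by_contra! hkl
  -- The place `l + 1` steps to the right of `i` is `a + 1` steps to the left of `i`.
  obtain ⟨a, ha⟩ : ∃ a, a + 1 + (l + 1) = N + 1 := ⟨N + 1 - (l + 1) - 1, by omega⟩
  have h1 := hR.2.2
  have h2 := hR.1 l le_rfl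
  rw [← iterate_finRotate_symm ha] at h1 h2
  rw [← iterate_finRotate_symm (a := a + 1 + 1) (by omega)] at h2
  rcases Nat.lt_or_ge a k with h | h
  · exact lt_asymm h2 (hL.1 (a + 1) (by omega))
  · obtain rfl : a = k := by omega
    have h3 := hL.2.2
    simp only at h1 h3
    rw [h3] at h1
    exact Bool.noConfusion h1

variable (π i)

/-- A guest is napkinless for exactly one pair of chain lengths, if at all. -/
theorem ite_tableAfter_eq_none :
    (if tableAfter π (N + 1) i = none then (1 : ℝ) else 0) =
      ∑ m ∈ Finset.range (N - 1), ∑ kl ∈ Finset.HasAntidiagonal.antidiagonal m,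
        open scoped Classical in
        if LeftChain π i kl.1 ∧ RightChain π i kl.2 then (1 : ℝ) else 0 := by
  classical
  rw [Finset.sum_sigma' (Finset.range (N - 1)) (fun m => Finset.HasAntidiagonal.antidiagonal m)]
  split_ifs with h
  · obtain ⟨⟨k, hk⟩, l, hl⟩ := (tableAfter_last_eq_none_iff_exists_chain π i).mp h
    have hkl := add_add_le_of_chains hk hl
    rw [Finset.sum_eq_single ⟨k + l, (k, l)⟩]
    · rw [if_pos ⟨hk, hl⟩]
    · rintro ⟨m, k', l'⟩ hm hne
      rw [if_neg]
      rintro ⟨hk', hl'⟩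
      obtain rfl := IsChain.unique hk hk'
      obtain rfl := IsChain.unique hl hl'
      simp at hm
      exact hne (by rw [← hm.2])
    · intro hn
      simp at hn
      omega
  · refine (Finset.sum_eq_zero fun x _ => if_neg fun hx => h ?_).symm
    exact (tableAfter_last_eq_none_iff_exists_chain π i).mpr ⟨⟨_, hx.1⟩, _, hx.2⟩

end Cyclic

theorem forall_lt_and_iff_forall_fin (k : ℕ) (t : ℕ → Bool) (b : Bool) :
    ((∀ j < k, ¬ t j = b) ∧ t k = b) ↔
      ∀ j : Fin (k + 1), t j = if (j : ℕ) = k then b else !b := by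
  constructor
  · rintro ⟨h1, h2⟩ j
    split_ifs with h
    · rw [h, h2]
    · exact Bool.eq_not_of_ne (h1 j (by omega))
  · intro h
    refine ⟨fun j hj => ?_, by simpa using h (Fin.last k)⟩
    have := h ⟨j, by omega⟩
    rw [if_neg (by simpa using hj.ne)] at this
    simp [this]

/-- The probability that the guest at place `i` has chains of `k + 1` guests on his left and of
`l + 1` guests on his right. -/
theorem sum_prob_chains {N k l : ℕ} (hkl : k + l + 3 ≤ N + 1) (i : Fin (N + 1)) (p q : ℝ)
    (hpq : p + q = 1) :
    ∑ π : SignedPerm (N + 1), prob p q π *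
        (open scoped Classical in
          if LeftChain π i k ∧ RightChain π i l then (1 : ℝ) else 0) =
      p ^ (k + 1) * q ^ (l + 1) / ((k + l + 3) * ((k + 1)! * (l + 1)!)) := by
  classical
  let x : Fin (k + 1) ↪ Fin (N + 1) := ⟨fun j => (finRotate (N + 1)).symm^[j + 1] i, by
    intro a b hab
    simp only at hab
    rw [iterate_finRotate_symm (b := N - a) (by omega),
      iterate_finRotate_symm (b := N - b) (by omega)] at hab
    have := iterate_finRotate_inj (by omega) (by omega) hab
    omega⟩
  let y : Fin (l + 1) ↪ Fin (N + 1) := ⟨fun j => (finRotate (N + 1))^[j + 1] i, by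
    intro a b hab
    have := iterate_finRotate_inj (by omega) (by omega) hab
    omega⟩
  have hxc (a) : x a ≠ i := by
    intro h
    have h' : (finRotate (N + 1)).symm^[a + 1] i = (finRotate (N + 1))^[0] i := h
    rw [iterate_finRotate_symm (b := N - a) (by omega)] at h'
    have := iterate_finRotate_inj (by omega) (by omega) h'
    omega
  have hyc (b) : y b ≠ i := by
    intro h
    have h' : (finRotate (N + 1))^[b + 1] i = (finRotate (N + 1))^[0] i := h
    have := iterate_finRotate_inj (by omega) (by omega) h'
    omega
  have hxy (a b) : x a ≠ y b := by
    intro h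
    have h' : (finRotate (N + 1)).symm^[a + 1] i = (finRotate (N + 1))^[b + 1] i := h
    rw [iterate_finRotate_symm (b := N - a) (by omega)] at h'
    have := iterate_finRotate_inj (by omega) (by omega) h'
    omega
  let g : Fin (k + 1 + (l + 1)) ↪ Fin (N + 1) := ⟨Fin.append x y,
    Fin.append_injective_iff.mpr ⟨x.injective, y.injective, hxy⟩⟩
  let bx : Fin (k + 1) → Bool := fun j => if (j : ℕ) = k then true else !true
  let bz : Fin (l + 1) → Bool := fun j => if (j : ℕ) = l then false else !false
  let w : Bool → ℝ := fun c => if c = true then q else p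
  let Ord : Equiv.Perm (Fin (N + 1)) → Prop := fun σ =>
    (((∀ j, σ (x j) < σ i) ∧ (∀ j, σ (y j) < σ i)) ∧ StrictAnti (σ ∘ x)) ∧ StrictAnti (σ ∘ y)
  have hiff (σ : Equiv.Perm (Fin (N + 1))) (s : Fin (N + 1) → Bool) :
      LeftChain (σ, s) i k ∧ RightChain (σ, s) i l ↔
        Ord σ ∧ ∀ j, s (g j) = Fin.append bx bz j := by
    have hg : (∀ j, s (g j) = Fin.append bx bz j) ↔
        (∀ j, s (x j) = bx j) ∧ ∀ j, s (y j) = bz j := by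
      constructor
      · intro h
        exact ⟨fun a => by simpa [g] using h (Fin.castAdd _ a),
          fun b => by simpa [g] using h (Fin.natAdd _ b)⟩
      · rintro ⟨h1, h2⟩ j
        refine Fin.addCases (fun a => ?_) (fun b => ?_) j
        · simpa [g] using h1 a
        · simpa [g] using h2 b
    have hX := forall_succ_lt_iff (k := k) (fun j => σ ((finRotate (N + 1)).symm^[j] i))
    have hY := forall_succ_lt_iff (k := l) (fun j => σ ((finRotate (N + 1))^[j] i))
    have hsX := forall_lt_and_iff_forall_fin k
      (fun j => s ((finRotate (N + 1)).symm^[j + 1] i)) true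
    have hsY := forall_lt_and_iff_forall_fin l (fun j => s ((finRotate (N + 1))^[j + 1] i)) false
    rw [hg]
    refine (and_congr (and_congr hX hsX) (and_congr hY hsY)).trans ?_
    exact ⟨fun ⟨⟨⟨a, b⟩, c⟩, ⟨d, e⟩, f⟩ => ⟨⟨⟨⟨a, d⟩, b⟩, e⟩, c, f⟩,
      fun ⟨⟨⟨⟨a, d⟩, b⟩, e⟩, c, f⟩ => ⟨⟨⟨a, b⟩, c⟩, ⟨d, e⟩, f⟩⟩
  have hprob (σ : Equiv.Perm (Fin (N + 1))) (s : Fin (N + 1) → Bool) :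
      prob p q (σ, s) = (∏ j, w (s j)) / ((N + 1)! : ℝ) := by
    simp only [w]
    rw [prob, Finset.prod_ite, Finset.prod_const, Finset.prod_const, mul_comm]
    simp [numNeg, numPos]
  have hsum : ∑ s : Fin (N + 1) → Bool,
      (if ∀ j, s (g j) = Fin.append bx bz j then ∏ j, w (s j) else 0) =
        p ^ (k + 1) * q ^ (l + 1) := by
    rw [sum_prod_ite_forall g _ w (by simp [w]; linarith), Fin.prod_univ_add]
    have h1 (j : Fin (k + 1)) : w (bx j) = if (j : ℕ) = k then q else p := by
      simp only [bx, w]; split_ifs <;> simp_all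
    have h2 (j : Fin (l + 1)) : w (bz j) = if (j : ℕ) = l then p else q := by
      simp only [bz, w]; split_ifs <;> simp_all
    simp only [Fin.append_left, Fin.append_right, h1, h2, prod_fin_succ_ite_last]
    ring
  have hcard := card_order_pattern i x y hxc hyc hxy
  have hterm (σ : Equiv.Perm (Fin (N + 1))) (s : Fin (N + 1) → Bool) :
      prob p q (σ, s) * (if LeftChain (σ, s) i k ∧ RightChain (σ, s) i l then (1 : ℝ) else 0) =
        (if Ord σ then 1 else 0) * ((if ∀ j, s (g j) = Fin.append bx bz j then
          ∏ j, w (s j) else 0) / ((N + 1)! : ℝ)) := by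
    rw [hprob, if_congr (hiff σ s) rfl rfl]
    by_cases h1 : Ord σ <;> by_cases h2 : ∀ j, s (g j) = Fin.append bx bz j <;> simp [h1, h2]
  rw [Fintype.sum_prod_type]
  simp only [hterm, ← Finset.mul_sum, ← Finset.sum_div, hsum]
  rw [← Finset.sum_mul, Finset.sum_boole]
  have hcard' : ((k : ℝ) + l + 3) * (((k + 1)! : ℝ) * (l + 1)!) *
      ((Finset.univ.filter Ord).card : ℝ) = ((N + 1)! : ℝ) := by
    rw [← hcard]
    push_cast
    ring
  have hne : ((N + 1)! : ℝ) ≠ 0 := by positivity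
  rw [← hcard'] at hne ⊢
  have hne' := right_ne_zero_of_mul hne
  field_simp

/-! ### Summation -/

/-- The binomial theorem without its two extreme terms. -/
theorem sum_antidiagonal_interior (m : ℕ) (p q : ℝ) (hpq : p + q = 1) :
    ∑ kl ∈ Finset.HasAntidiagonal.antidiagonal m,
        p ^ (kl.1 + 1) * q ^ (kl.2 + 1) / ((kl.1 + kl.2 + 3) * ((kl.1 + 1)! * (kl.2 + 1)!)) =
      (1 - p ^ (m + 2) - q ^ (m + 2)) / ((m + 3)! : ℝ) := by
  have h : ∑ kl ∈ Finset.HasAntidiagonal.antidiagonal (m + 2),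
      (p ^ kl.1 / kl.1 ! * (q ^ kl.2 / kl.2 !)) = 1 / ((m + 2)! : ℝ) := by
    have hb := (Commute.all p q).add_pow' (m + 2)
    rw [hpq, one_pow] at hb
    rw [hb, Finset.sum_div]
    refine Finset.sum_congr rfl fun kl hkl => ?_
    obtain ⟨a, b⟩ := kl
    rw [Finset.HasAntidiagonal.mem_antidiagonal] at hkl
    simp only at hkl ⊢
    have hc := Nat.add_choose_mul_factorial_mul_factorial a b
    rw [← Nat.choose_symm_add, hkl] at hc
    rw [← hc, nsmul_eq_mul]
    have : (((m + 2).choose a : ℕ) : ℝ) ≠ 0 := by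
      exact_mod_cast (Nat.choose_pos (by omega)).ne'
    push_cast
    field_simp
  rw [Finset.Nat.antidiagonal_succ_succ'] at h
  simp only [Finset.sum_cons, Finset.sum_map, Function.Embedding.prodMap,
    Function.Embedding.coeFn_mk, Prod.map, pow_zero, Nat.factorial_zero, Nat.cast_one, div_one,
    one_mul, mul_one, Nat.succ_eq_add_one] at h
  have hterm (kl) (hkl : kl ∈ Finset.HasAntidiagonal.antidiagonal m) :
      p ^ (kl.1 + 1) * q ^ (kl.2 + 1) / (((kl.1 : ℝ) + kl.2 + 3) * ((kl.1 + 1)! * (kl.2 + 1)!)) =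
        p ^ (kl.1 + 1) / (kl.1 + 1)! * (q ^ (kl.2 + 1) / (kl.2 + 1)!) / ((m : ℝ) + 3) := by
    rw [Finset.HasAntidiagonal.mem_antidiagonal] at hkl
    have : (m : ℝ) = kl.1 + kl.2 := by exact_mod_cast hkl.symm
    rw [this]
    field_simp
  rw [Finset.sum_congr rfl hterm, ← Finset.sum_div]
  have h' : ∑ kl ∈ Finset.HasAntidiagonal.antidiagonal m,
      p ^ (kl.1 + 1) / (kl.1 + 1)! * (q ^ (kl.2 + 1) / (kl.2 + 1)!) =
        (1 - p ^ (m + 2) - q ^ (m + 2)) / ((m + 2)! : ℝ) := by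
    rw [sub_div, sub_div]
    have := h
    simp at this
    linarith
  rw [h', Nat.factorial_succ (m + 2)]
  push_cast
  rw [div_div]
  congr 1
  ring

/-- Comparing coefficients: the term of degree `m` of the right-hand side is
`(1 - p ^ (m - 1) - q ^ (m - 1)) / m!` for `m ≥ 1`, and those of degrees `0`, `1`, `2` are
`1`, `-1`, `0`. -/
theorem sum_interior_eq_truncExp (N : ℕ) (p q : ℝ) (hp : p ≠ 0) (hq : q ≠ 0) (hpq : p + q = 1) :
    ∑ m ∈ Finset.range (N - 1), (1 - p ^ (m + 2) - q ^ (m + 2)) / ((m + 3)! : ℝ) =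
      1 / (p * q) * (1 - p * truncExp (N + 1) q - q * truncExp (N + 1) p
        + p * q * truncExp (N + 1) 1) := by
  obtain rfl : q = 1 - p := by linarith
  induction N with
  | zero =>
    simp [truncExp, Finset.sum_range_succ]
    right
    ring
  | succ N ih =>
    have hT (x : ℝ) : truncExp (N + 1 + 1) x =
        truncExp (N + 1) x + x ^ (N + 2) / ((N + 2)! : ℝ) := by
      rw [truncExp, Finset.sum_range_succ]
      rfl
    rw [hT, hT, hT]
    cases N with
    | zero =>
      simp [truncExp, Finset.sum_range_succ]
      right
      ring
    | succ M =>
      have e1 : M + 1 + 1 - 1 = M + 1 := rfl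
      have e2 : M + 1 - 1 = M := rfl
      rw [e2] at ih
      rw [e1, Finset.sum_range_succ, ih]
      have : ((M + 1 + 2)! : ℝ) ≠ 0 := by positivity
      have e3 : (M + 3)! = (M + 1 + 2)! := rfl
      rw [e3]
      field_simp
      ring

end Napkin

theorem mainTheorem5 (n : ℕ) (hn : 1 ≤ n) (p q : ℝ) (hp0 : 0 < p) (hp1 : p < 1)
    (hq : q = 1 - p) :
    Napkin.expectedNapkinless n p q =
      (n : ℝ) / (p * q) *
        (1 - p * Napkin.truncExp n q - q * Napkin.truncExp n p
          + p * q * Napkin.truncExp n 1) := by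
  obtain ⟨N, rfl⟩ : ∃ N, n = N + 1 := ⟨n - 1, by omega⟩
  have hpq : p + q = 1 := by linarith
  have hplace (i : Fin (N + 1)) : ∑ π : Napkin.SignedPerm (N + 1), Napkin.prob p q π *
      (if Napkin.tableAfter π (N + 1) i = none then (1 : ℝ) else 0) =
        ∑ m ∈ Finset.range (N - 1), (1 - p ^ (m + 2) - q ^ (m + 2)) / ((m + 3)! : ℝ) := by
    simp only [Napkin.ite_tableAfter_eq_none, Finset.mul_sum]
    rw [Finset.sum_comm]
    refine Finset.sum_congr rfl fun m hm => ?_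
    rw [Finset.sum_comm, ← Napkin.sum_antidiagonal_interior m p q hpq]
    refine Finset.sum_congr rfl fun kl hkl => ?_
    rw [Finset.HasAntidiagonal.mem_antidiagonal] at hkl
    rw [Finset.mem_range] at hm
    exact Napkin.sum_prob_chains (by omega) i p q hpq
  have hcard (π : Napkin.SignedPerm (N + 1)) : (Napkin.numNapkinless π : ℝ) =
      ∑ i, if Napkin.tableAfter π (N + 1) i = none then (1 : ℝ) else 0 := by
    rw [Finset.sum_boole]
    rfl
  simp only [Napkin.expectedNapkinless, hcard, Finset.mul_sum]
  rw [Finset.sum_comm]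
  simp only [hplace]
  rw [Napkin.sum_interior_eq_truncExp N p q hp0.ne' (by linarith) hpq]
  simp only [Finset.sum_const, Finset.card_univ, Fintype.card_fin, nsmul_eq_mul]
  ring
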